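/- Let $k$ be a field, let $\phi\colon A\to B$ be a morphism of (unital, associative) $k$-algebras and let $M$ be a left $A$-module. Write $T_q=\operatorname{Tor}_q^A(B,M)$, a left $B$-module, with $T_q=0$ for $q<0$. For a left $B$-module $N$, choose a projective resolution $X_\bullet\to M$ of the $A$-module $M$ and an injective resolution $N\to Y^\bullet$ of the $B$-module $N$, and consider the total complex $Z=\operatorname{Hom}_B(B\otimes_A X_\bullet,Y^\bullet)$, $Z^n=\bigoplus_{r+s=n}\operatorname{Hom}_B(B\otimes_A X_r,Y^s)$, with differential $z\mapsto d_Y\circ z+(-1)^{n+1}z\circ d_{B\otimes X}$ in degree $n$. The change-of-rings spectral sequence $\operatorname{Ext}_B^p(\operatorname{Tor}_q^A(B,M),N)\Rightarrow\operatorname{Ext}_A^{p+q}(M,N)$ is the spectral sequence of $Z$ filtered by $F^pZ^n=\bigoplus_{r+s=n,\ s\ge p}\operatorname{Hom}_B(B\otimes_A X_r,Y^s)$. Its second page is identified with $E_2^{p,q}\cong\operatorname{Ext}_B^p(T_q,N)$: an element of $E_2^{p,q}$ represented by $z\in F^pZ^{p+q}$ with $dz\in F^{p+2}Z^{p+q+1}$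 corresponds to the class of the cocycle $T_q=H_q(B\otimes_A X_\bullet)\to Y^p$ induced by the component $B\otimes_A X_q\to Y^p$ of $z$. (The convergence is recalled only to name the spectral sequence; it is not part of the assertion.) **Theorem.** For each integer $q$ there is a class $\mathcal O_q(M)\in\operatorname{Ext}^2_B(T_{q-1},T_q)$ such that for every left $B$-module $N$, every choice of resolutions $X_\bullet$ and $Y^\bullet$ as above, every $p\ge 0$ and every $\zeta\in\operatorname{Ext}_B^p(T_q,N)$, the differential $d_2^{p,q}\colon\operatorname{Ext}_B^p(T_q,N)\to\operatorname{Ext}_B^{p+2}(T_{q-1},N)$ of the second page is given by $$d_2^{p,q}(\zeta)=(-1)^p\,\zeta\circ\mathcal O_q(M),$$ where $\circ$ is the Yoneda product. (For $q\le 0$ both sides are zero.) -/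

import Mathlib

open CategoryTheory CategoryTheory.Limits CategoryTheory.Abelian
open CochainComplex CochainComplex.HomComplex
open scoped TensorProduct

universe w u v

namespace ChangeOfRings

noncomputable section

/-! ### The functor `B ⊗_A -` for a morphism of (noncommutative) rings `A → B` -/

section Tensor

variable {A B : Type u} [Ring A] [Ring B] (φ : A →+* B)

/-- The left `B`-submodule of `B ⊗_ℤ M` generated by the elements
`b φ(a) ⊗ m - b ⊗ a m`. -/
def tensorRelations (M : Type u) [AddCommGroup M] [Module A M] : Submodule B (B ⊗[ℤ] M) :=
  Submodule.span B
    {x | ∃ (b : B) (a : A) (m : M), x = (b * φ a) ⊗ₜ[ℤ] m - b ⊗ₜ[ℤ] (a • m)}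

/-- The left `B`-module `B ⊗_A M`, where `B` is a right `A`-module through `φ`. -/
abbrev TensorObj (M : Type u) [AddCommGroup M] [Module A M] : Type u :=
  (B ⊗[ℤ] M) ⧸ tensorRelations φ M

/-- The `B`-linear map `id ⊗ f : B ⊗_A M → B ⊗_A M'` induced by an `A`-linear map `f`. -/
def tensorMap {M M' : Type u} [AddCommGroup M] [Module A M] [AddCommGroup M'] [Module A M']
    (f : M →ₗ[A] M') : TensorObj φ M →ₗ[B] TensorObj φ M' :=
  Submodule.mapQ (tensorRelations φ M) (tensorRelations φ M')
    (TensorProduct.AlgebraTensorModule.map (LinearMap.id : B →ₗ[B] B) f.toAddMonoidHom.toIntLinearMap)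
    (by
      rw [tensorRelations, Submodule.span_le]
      rintro x ⟨b, a, m, rfl⟩
      refine Submodule.subset_span ⟨b, a, f m, ?_⟩
      simp)

lemma tensorMap_mk {M M' : Type u} [AddCommGroup M] [Module A M] [AddCommGroup M'] [Module A M']
    (f : M →ₗ[A] M') (b : B) (m : M) :
    tensorMap φ f (Submodule.Quotient.mk (b ⊗ₜ[ℤ] m)) = Submodule.Quotient.mk (b ⊗ₜ[ℤ] f m) :=
  rfl

lemma tensorObj_hom_ext {M : Type u} [AddCommGroup M] [Module A M] {P : Type u}
    [AddCommGroup P] [Module B P] {f g : TensorObj φ M →ₗ[B] P}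
    (h : ∀ (b : B) (m : M),
      f (Submodule.Quotient.mk (b ⊗ₜ[ℤ] m)) = g (Submodule.Quotient.mk (b ⊗ₜ[ℤ] m))) :
    f = g := by
  refine LinearMap.ext fun x => ?_
  obtain ⟨x, rfl⟩ := Submodule.Quotient.mk_surjective _ x
  induction x with
  | zero => simp
  | tmul b m => exact h b m
  | add x y hx hy => rw [Submodule.Quotient.mk_add, map_add, map_add, hx, hy]

/-- The functor `B ⊗_A -` from left `A`-modules to left `B`-modules. -/
def tensorFunctor : ModuleCat.{u} A ⥤ ModuleCat.{u} B where
  obj M := ModuleCat.of B (TensorObj φ M)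
  map f := ModuleCat.ofHom (tensorMap φ f.hom)
  map_id M := by
    ext1
    exact tensorObj_hom_ext φ fun b m => rfl
  map_comp f g := by
    ext1
    exact tensorObj_hom_ext φ fun b m => rfl

instance : (tensorFunctor φ).Additive where
  map_add {M M' f g} := by
    ext1
    refine tensorObj_hom_ext φ fun b m => ?_
    change Submodule.Quotient.mk (b ⊗ₜ[ℤ] (f.hom m + g.hom m)) = _
    rw [TensorProduct.tmul_add, Submodule.Quotient.mk_add]
    rfl

/-- `Tor_n^A(B, M)` as a left `B`-module: the left derived functors of `B ⊗_A -` for `n ≥ 0`,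
and zero for `n < 0`. -/
def tor (M : ModuleCat.{u} A) : ℤ → ModuleCat.{u} B
  | .ofNat n => ((tensorFunctor φ).leftDerived n).obj M
  | .negSucc _ => ModuleCat.of B PUnit.{u + 1}

/-- The complex `B ⊗_A X` attached to a projective resolution `X` of `M`, as a cochain complex
indexed by the integers: `B ⊗_A X_n` sits in degree `-n`. -/
def tensorComplex {M : ModuleCat.{u} A} (X : ProjectiveResolution M) :
    CochainComplex (ModuleCat.{u} B) ℤ :=
  (((tensorFunctor φ).mapHomologicalComplex (ComplexShape.down ℕ)).obj X.complex).extend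
    ComplexShape.embeddingDownNat

/-- The canonical isomorphism between `Tor_n^A(B, M)` and the `n`-th homology of `B ⊗_A X`. -/
def torIso {M : ModuleCat.{u} A} (X : ProjectiveResolution M) :
    ∀ n : ℤ, tor φ M n ≅ (tensorComplex φ X).homology (-n)
  | .ofNat n =>
    X.isoLeftDerivedObj (tensorFunctor φ) n ≪≫
      ((((tensorFunctor φ).mapHomologicalComplex (ComplexShape.down ℕ)).obj
        X.complex).extendHomologyIso ComplexShape.embeddingDownNat (j := n) rfl).symm
  | .negSucc n =>
    (ModuleCat.isZero_of_subsingleton (ModuleCat.of B PUnit.{u + 1})).iso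
      (((((tensorFunctor φ).mapHomologicalComplex (ComplexShape.down ℕ)).obj
        X.complex).extend_exactAt ComplexShape.embeddingDownNat _ (fun j hj => by
          simp only [ComplexShape.embeddingDownNat_f] at hj
          lia)).isZero_homology)

end Tensor

/-! ### The spectral sequence of the complex `Hom(K, L)` filtered by the degree in `L`

`Cochain K L n` is the degree `n` term `∏_{j - i = n} Hom(K^i, L^j)` of the total complex, and
`δ` is its differential, `δ z = d_L ∘ z + (-1)^(n+1) z ∘ d_K` in degree `n`. -/

section SpectralSequence

variable {C : Type u} [Category.{v} C] [Preadditive C] (K L : CochainComplex C ℤ)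

/-- The subgroup `F^p` of the cochains of degree `n` all of whose components with values in `L^j`,
for `j < p`, vanish. -/
def filtration (p n : ℤ) : AddSubgroup (Cochain K L n) where
  carrier := {z | ∀ (i j : ℤ) (h : i + n = j), j < p → z.v i j h = 0}
  zero_mem' := fun _ _ _ _ => rfl
  add_mem' := fun {a b} ha hb i j h hj => by
    rw [Cochain.add_v, ha i j h hj, hb i j h hj, add_zero]
  neg_mem' := fun {a} ha i j h hj => by
    rw [Cochain.neg_v, ha i j h hj, neg_zero]

/-- The differential of `Hom(K, L)`, as a morphism of groups. -/
def diff (n m : ℤ) : Cochain K L n →+ Cochain K L m :=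
  (δ_hom ℤ K L n m).toAddMonoidHom

/-- `Z_r^p = {z ∈ F^p | δ z ∈ F^(p+r)}` in degree `n`. -/
def approxCycles (r p n : ℤ) : AddSubgroup (Cochain K L n) :=
  filtration K L p n ⊓ (filtration K L (p + r) (n + 1)).comap (diff K L n (n + 1))

/-- `Z_{r-1}^{p+1} + δ Z_{r-1}^{p-r+1}` in degree `n`. -/
def approxBoundaries (r p n : ℤ) : AddSubgroup (Cochain K L n) :=
  approxCycles K L (r - 1) (p + 1) n ⊔
    (approxCycles K L (r - 1) (p - r + 1) (n - 1)).map (diff K L (n - 1) n)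

/-- The term `E_r^{p, n - p}` (of filtration degree `p` and total degree `n`) of the spectral
sequence of the filtered complex `Hom(K, L)`, that is
`Z_r^p / (Z_{r-1}^{p+1} + δ Z_{r-1}^{p-r+1})`. -/
abbrev page (r p n : ℤ) : Type v :=
  approxCycles K L r p n ⧸ (approxBoundaries K L r p n).addSubgroupOf (approxCycles K L r p n)

variable {K L}

lemma diff_mem {r p p' n n' : ℤ} (hp : p + r = p') (hn : n + 1 = n')
    {z : Cochain K L n} (hz : z ∈ approxCycles K L r p n) :
    diff K L n n' z ∈ approxCycles K L r p' n' := by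
  subst hp hn
  refine ⟨hz.2, ?_⟩
  change δ _ _ (δ _ _ z) ∈ filtration K L _ _
  rw [δ_δ]
  exact zero_mem _

variable (K L) in
/-- The differential `d_r : E_r^{p, n - p} → E_r^{p + r, n + 1 - (p + r)}`, the class of `z` being
sent to the class of `δ z`. -/
def pageD (r p p' n n' : ℤ) (hp : p + r = p') (hn : n + 1 = n') :
    page K L r p n →+ page K L r p' n' :=
  QuotientAddGroup.map _ _
    (((diff K L n n').comp (approxCycles K L r p n).subtype).codRestrict
      (approxCycles K L r p' n') (fun z => diff_mem hp hn z.2))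
    (by
      subst hp hn
      rintro ⟨z, hz⟩ hz'
      change z ∈ approxBoundaries K L r p n at hz'
      change diff K L n (n + 1) z ∈ approxBoundaries K L r (p + r) (n + 1)
      obtain ⟨x, hx, y, ⟨y, -, rfl⟩, rfl⟩ := AddSubgroup.mem_sup.1 hz'
      rw [map_add]
      have h0 : diff K L n (n + 1) (diff K L (n - 1) n y) = 0 := by
        change δ _ _ (δ _ _ y) = 0
        rw [δ_δ]
      rw [h0, add_zero]
      refine AddSubgroup.mem_sup_right ?_
      have e1 : p + r - r + 1 = p + 1 := by lia
      have e2 : n + 1 - 1 = n := by lia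
      rw [e1, e2]
      exact ⟨x, hx, rfl⟩)

end SpectralSequence

/-! ### The identification of the second page -/

section SecondPage

variable {C : Type u} [Category.{v} C] [Abelian C] {K L : CochainComplex C ℤ}

lemma d_comp_leading {r p n q : ℤ} (hr : 1 ≤ r) (h : p + q = n) {z : Cochain K L n}
    (hz : z ∈ approxCycles K L r p n) :
    K.d (-q - 1) (-q) ≫ z.v (-q) p (by lia) = 0 := by
  have h1 : (δ n (n + 1) z).v (-q - 1) p (by lia) = 0 := hz.2 _ _ _ (by lia)
  rw [δ_v n (n + 1) rfl z (-q - 1) p (by lia) (p - 1) (-q) rfl (by lia),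
    hz.1 (-q - 1) (p - 1) (by lia) (by lia), zero_comp, zero_add] at h1
  exact (smul_eq_zero_iff_eq _).1 h1

/-- The morphism `H^{-q}(K) → L^p` induced by the component `K^{-q} → L^p` of an element of `Z_2^p`
of degree `n = p + q`. -/
def leading {p n q : ℤ} (h : p + q = n) (z : approxCycles K L 2 p n) :
    K.homology (-q) ⟶ L.X p :=
  K.homologyι (-q) ≫ K.descOpcycles ((z : Cochain K L n).v (-q) p (by lia)) (-q - 1) (by simp)
    (d_comp_leading (by lia) h z.2)

lemma leading_add {p n q : ℤ} (h : p + q = n) (z z' : approxCycles K L 2 p n) :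
    leading h (z + z') = leading h z + leading h z' := by
  rw [leading, leading, leading, ← Preadditive.comp_add]
  congr 1
  simp [← cancel_epi (K.pOpcycles (-q))]

lemma leading_comp_d {p n q : ℤ} (h : p + q = n) (z : approxCycles K L 2 p n) :
    leading h z ≫ L.d p (p + 1) = 0 := by
  have h1 : (δ n (n + 1) (z : Cochain K L n)).v (-q) (p + 1) (by lia) = 0 :=
    z.2.2 _ _ _ (by lia)
  rw [δ_v n (n + 1) rfl _ (-q) (p + 1) (by lia) p (-q + 1) (by lia) rfl] at h1
  have h2 : K.descOpcycles ((z : Cochain K L n).v (-q) p (by lia)) (-q - 1) (by simp)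
      (d_comp_leading (by lia) h z.2) ≫ L.d p (p + 1) =
      -((n + 1).negOnePow • (K.fromOpcycles (-q) (-q + 1) ≫
        (z : Cochain K L n).v (-q + 1) (p + 1) (by lia))) := by
    rw [← cancel_epi (K.pOpcycles (-q))]
    simpa using eq_neg_of_add_eq_zero_left h1
  rw [leading, Category.assoc, h2]
  simp

lemma leading_eq_zero_of_mem {p n q : ℤ} (h : p + q = n) (z : approxCycles K L 2 p n)
    (hz : (z : Cochain K L n) ∈ approxCycles K L (2 - 1) (p + 1) n) : leading h z = 0 := by
  have h1 : (z : Cochain K L n).v (-q) p (by lia) = 0 := hz.1 _ _ _ (by lia)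
  rw [leading]
  have : K.descOpcycles ((z : Cochain K L n).v (-q) p (by lia)) (-q - 1) (by simp)
      (d_comp_leading (by lia) h z.2) = 0 := by
    rw [← cancel_epi (K.pOpcycles (-q))]
    simpa using h1
  rw [this, comp_zero]

lemma leading_eq_of_eq_diff {p n q : ℤ} (h : p + q = n) (z : approxCycles K L 2 p n)
    (y : Cochain K L (n - 1)) (hy : y ∈ approxCycles K L (2 - 1) (p - 2 + 1) (n - 1))
    (hz : diff K L (n - 1) n y = z) :
    ∃ g : K.homology (-q) ⟶ L.X (p - 1), g ≫ L.d (p - 1) p = leading h z := by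
  have e : p - 2 + 1 = p - 1 := by lia
  rw [e] at hy
  refine ⟨K.homologyι (-q) ≫ K.descOpcycles (y.v (-q) (p - 1) (by lia)) (-q - 1) (by simp)
    (d_comp_leading (by lia) (by lia) hy), ?_⟩
  have h1 := Cochain.congr_v hz (-q) p (by lia)
  change (δ (n - 1) n y).v _ _ _ = _ at h1
  rw [δ_v (n - 1) n (by lia) _ (-q) p (by lia) (p - 1) (-q + 1) rfl rfl] at h1
  have h2 : K.descOpcycles ((z : Cochain K L n).v (-q) p (by lia)) (-q - 1) (by simp)
      (d_comp_leading (by lia) h z.2) =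
      K.descOpcycles (y.v (-q) (p - 1) (by lia)) (-q - 1) (by simp)
        (d_comp_leading (by lia) (by lia) hy) ≫ L.d (p - 1) p +
      n.negOnePow • (K.fromOpcycles (-q) (-q + 1) ≫ y.v (-q + 1) p (by lia)) := by
    rw [← cancel_epi (K.pOpcycles (-q))]
    simpa using h1.symm
  rw [leading, h2]
  simp

lemma exists_extension {i : ℤ} {J : C} [Injective J] (f : K.opcycles i ⟶ J)
    (hf : K.homologyι i ≫ f = 0) :
    ∃ v : K.X (i + 1) ⟶ J, K.fromOpcycles i (i + 1) ≫ v = f := by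
  have h := ShortComplex.exact_of_f_is_kernel
    (ShortComplex.mk _ _ (K.homologyι_comp_fromOpcycles i (i + 1)))
    (K.homologyIsKernel i (i + 1) (by simp))
  exact ⟨h.descToInjective f hf, h.comp_descToInjective f hf⟩

/-- The cochain of degree `n` whose only components are `f : K^i → L^j` and
`g : K^(i+1) → L^(j+1)`. -/
def pair (n : ℤ) {i j : ℤ} (f : K.X i ⟶ L.X j) (g : K.X (i + 1) ⟶ L.X (j + 1)) :
    Cochain K L n :=
  Cochain.single f n + Cochain.single g n

lemma pair_v_fst (n : ℤ) {i j : ℤ} (f : K.X i ⟶ L.X j) (g : K.X (i + 1) ⟶ L.X (j + 1))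
    (h : i + n = j) : (pair n f g).v i j h = f := by
  rw [pair, Cochain.add_v, Cochain.single_v, Cochain.single_v_eq_zero _ _ _ _ _ (by lia), add_zero]

lemma pair_v_snd (n : ℤ) {i j : ℤ} (f : K.X i ⟶ L.X j) (g : K.X (i + 1) ⟶ L.X (j + 1))
    (h : i + 1 + n = j + 1) : (pair n f g).v (i + 1) (j + 1) h = g := by
  rw [pair, Cochain.add_v, Cochain.single_v, Cochain.single_v_eq_zero _ _ _ _ _ (by lia), zero_add]

lemma pair_mem_filtration (n : ℤ) {i j : ℤ} (f : K.X i ⟶ L.X j) (g : K.X (i + 1) ⟶ L.X (j + 1)) :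
    pair n f g ∈ filtration K L j n := by
  intro i' j' h hj
  rw [pair, Cochain.add_v, Cochain.single_v_eq_zero' _ _ _ _ _ (by lia),
    Cochain.single_v_eq_zero' _ _ _ _ _ (by lia), add_zero]

lemma pair_mem_approxCycles {n : ℤ} {i j : ℤ} (h : i + n = j)
    (f : K.X i ⟶ L.X j) (g : K.X (i + 1) ⟶ L.X (j + 1)) (hf : K.d (i - 1) i ≫ f = 0) :
    pair n f g ∈ approxCycles K L 1 j n := by
  refine ⟨pair_mem_filtration n f g, ?_⟩
  intro i' j' h' hj
  change (δ _ _ _).v _ _ _ = 0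
  rw [δ_v n (n + 1) rfl _ i' j' h' (j' - 1) (i' + 1) rfl rfl,
    pair_mem_filtration n f g i' (j' - 1) (by lia) (by lia), zero_comp, zero_add]
  by_cases hj' : j' < j
  · rw [pair_mem_filtration n f g (i' + 1) j' (by lia) hj', comp_zero, smul_zero]
  · obtain rfl : j' = j := by lia
    obtain rfl : i' = i - 1 := by lia
    have e : i - 1 + 1 = i := by lia
    have : ∀ (a : ℤ) (ha : a = i), K.d (i - 1) a ≫ (pair n f g).v a j' (by lia) = 0 := by
      rintro a rfl
      rw [pair_v_fst, hf]
    rw [this _ e, smul_zero]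

lemma mem_approxBoundaries {p n q : ℤ} (h : p + q = n) [Injective (L.X (p - 1))]
    [Injective (L.X p)]
    (z : approxCycles K L 2 p n) (g : K.homology (-q) ⟶ L.X (p - 1))
    (hg : g ≫ L.d (p - 1) p = leading h z) :
    (z : Cochain K L n) ∈ approxBoundaries K L 2 p n := by
  let w := Injective.factorThru g (K.homologyι (-q))
  have hw : K.homologyι (-q) ≫ w = g := Injective.comp_factorThru _ _
  obtain ⟨v, hv⟩ := exists_extension
    (K.descOpcycles ((z : Cochain K L n).v (-q) p (by lia)) (-q - 1) (by simp)
      (d_comp_leading (by lia) h z.2) - w ≫ L.d (p - 1) p)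
    (by rw [Preadditive.comp_sub, reassoc_of% hw, hg, leading, sub_self])
  have hv' : (z : Cochain K L n).v (-q) p (by lia) =
      K.pOpcycles (-q) ≫ w ≫ L.d (p - 1) p + K.d (-q) (-q + 1) ≫ v := by
    rw [← cancel_epi (K.pOpcycles (-q))] at hv
    simp only [HomologicalComplex.p_fromOpcycles_assoc, Preadditive.comp_sub,
      HomologicalComplex.p_descOpcycles] at hv
    rw [hv]
    abel
  obtain ⟨p', rfl⟩ : ∃ p', p = p' + 1 := ⟨p - 1, by lia⟩
  have e1 : p' + 1 - 1 = p' := by lia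
  have e2 : p' + 1 - 2 + 1 = p' := by lia
  clear_value w
  clear hv hg hw
  revert w v
  generalize p' + 1 - 1 = a at *
  subst e1
  intro w v hv'
  let y : Cochain K L (n - 1) := pair (n - 1) (K.pOpcycles (-q) ≫ w) (n.negOnePow • v)
  have hy : y ∈ approxCycles K L 1 a (n - 1) :=
    pair_mem_approxCycles (by lia) _ _ (by simp)
  refine AddSubgroup.mem_sup.2 ⟨z - diff K L (n - 1) n y, ?_, diff K L (n - 1) n y,
    ⟨y, by rw [e2]; exact hy, rfl⟩, by abel⟩
  have hy2 := diff_mem rfl (show n - 1 + 1 = n by lia) hy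
  refine ⟨?_, ?_⟩
  · intro i j hij hj
    by_cases hj' : j < a + 1
    · exact (filtration K L (a + 1) n).sub_mem z.2.1 hy2.1 i j hij hj'
    · obtain rfl : j = a + 1 := by lia
      obtain rfl : i = -q := by lia
      rw [Cochain.sub_v, hv']
      change _ - (δ _ _ y).v _ _ _ = 0
      rw [δ_v (n - 1) n (by lia) _ (-q) (a + 1) (by lia) a (-q + 1) (by lia) rfl,
        pair_v_fst, pair_v_snd]
      simp [smul_smul]
  · change diff K L n (n + 1) _ ∈ filtration K L (a + 1 + 1 + (2 - 1)) (n + 1)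
    rw [map_sub]
    have h0 : diff K L n (n + 1) (diff K L (n - 1) n y) = 0 := by
      change δ _ _ (δ _ _ y) = 0
      rw [δ_δ]
    rw [h0, sub_zero]
    have := z.2.2
    have e3 : a + 1 + 1 + (2 - 1) = a + 1 + 2 := by lia
    rw [e3]
    exact this

lemma exists_leading_eq {p n q : ℤ} (h : p + q = n) [Injective (L.X (p + 1))]
    [Injective (L.X p)] (f : K.homology (-q) ⟶ L.X p) (hf : f ≫ L.d p (p + 1) = 0) :
    ∃ z : approxCycles K L 2 p n, leading h z = f := by
  let g := Injective.factorThru f (K.homologyι (-q))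
  have hg : K.homologyι (-q) ≫ g = f := Injective.comp_factorThru _ _
  obtain ⟨v, hv⟩ := exists_extension (g ≫ L.d p (p + 1)) (by rw [reassoc_of% hg, hf])
  let z : Cochain K L n := pair n (K.pOpcycles (-q) ≫ g) (-((n + 1).negOnePow • v))
  have hz : z ∈ approxCycles K L 1 p n :=
    pair_mem_approxCycles (by lia) _ _ (by simp)
  have hz' : z ∈ approxCycles K L 2 p n := by
    refine ⟨hz.1, ?_⟩
    intro i j hij hj
    by_cases hj' : j < p + 1
    · exact hz.2 i j hij hj'
    · obtain rfl : j = p + 1 := by lia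
      obtain rfl : i = -q := by lia
      change (δ _ _ z).v _ _ _ = 0
      rw [δ_v n (n + 1) rfl _ (-q) (p + 1) (by lia) p (-q + 1) (by lia) rfl,
        pair_v_fst, pair_v_snd, Category.assoc, ← hv]
      simp [smul_smul]
  refine ⟨⟨z, hz'⟩, ?_⟩
  rw [← hg, leading]
  congr 1
  rw [← cancel_epi (K.pOpcycles (-q)), HomologicalComplex.p_descOpcycles]
  exact pair_v_fst _ _ _ _

variable {N : C} (Y : InjectiveResolution N)

lemma cocycle_condition {p : ℕ} {n q : ℤ} (h : p + q = n) {T : C} (e : T ≅ K.homology (-q))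
    (z : approxCycles K Y.cochainComplex 2 p n) :
    (e.hom ≫ leading h z ≫ (Y.cochainComplexXIso p p rfl).hom) ≫ Y.cocomplex.d p (p + 1) = 0 := by
  have h1 := leading_comp_d h z
  rw [Y.cochainComplex_d p (p + 1) p (p + 1) rfl (by simp), ← Category.assoc,
    ← Category.assoc, Preadditive.IsIso.comp_right_eq_zero] at h1
  rw [Category.assoc, h1, comp_zero]

variable [HasExt.{w} C]

lemma extMk_eq_zero_iff_int {T : C} {p : ℕ} (f : T ⟶ Y.cochainComplex.X p)
    (hf : (f ≫ (Y.cochainComplexXIso p p rfl).hom) ≫ Y.cocomplex.d p (p + 1) = 0) :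
    (Y.extMk (f ≫ (Y.cochainComplexXIso p p rfl).hom) (p + 1) rfl hf : Ext.{w} T N p) = 0 ↔
      ∃ g : T ⟶ Y.cochainComplex.X (p - 1), g ≫ Y.cochainComplex.d (p - 1) p = f := by
  rw [← Y.extEquivCohomologyClass.apply_eq_iff_eq, Y.extEquivCohomologyClass_extMk,
    Y.extEquivCohomologyClass_zero, CohomologyClass.mk_eq_zero_iff,
    Cocycle.fromSingleMk_mem_coboundaries_iff _ _ _ _ _ (p - 1 : ℤ) (by lia)]
  simp

/-- The class in `Ext^p(H^{-q}(K), N)` attached to an element of `Z_2^p` of degree `n = p + q`: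
it is represented by the cocycle `H^{-q}(K) → Y^p` of the complex `Hom(H^{-q}(K), Y)`. The object
`H^{-q}(K)` is replaced here by an isomorphic object `T`. -/
def cyclesToExt {p : ℕ} {n q : ℤ} (h : p + q = n) {T : C} (e : T ≅ K.homology (-q)) :
    approxCycles K Y.cochainComplex 2 p n →+ Ext.{w} T N p :=
  AddMonoidHom.mk'
    (fun z => Y.extMk (e.hom ≫ leading h z ≫ (Y.cochainComplexXIso p p rfl).hom) (p + 1) rfl
      (cocycle_condition Y h e z))
    (fun z z' => by
      rw [Y.add_extMk]
      congr 1
      rw [leading_add, Preadditive.add_comp, Preadditive.comp_add])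

lemma cyclesToExt_eq_zero_iff' {p : ℕ} {n q : ℤ} (h : p + q = n) {T : C}
    (e : T ≅ K.homology (-q)) (z : approxCycles K Y.cochainComplex 2 p n) :
    cyclesToExt.{w} Y h e z = 0 ↔ ∃ g : K.homology (-q) ⟶ Y.cochainComplex.X (p - 1),
      g ≫ Y.cochainComplex.d (p - 1) p = leading h z := by
  have hz := cocycle_condition Y h e z
  rw [← Category.assoc e.hom] at hz
  have := extMk_eq_zero_iff_int.{w} Y (e.hom ≫ leading h z) hz
  simp only [Category.assoc] at this
  refine this.trans ⟨fun ⟨g, hg⟩ => ⟨e.inv ≫ g, ?_⟩, fun ⟨g, hg⟩ => ⟨e.hom ≫ g, ?_⟩⟩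
  · rw [Category.assoc, hg, e.inv_hom_id_assoc]
  · rw [Category.assoc, hg]

lemma cyclesToExt_eq_zero_iff {p : ℕ} {n q : ℤ} (h : p + q = n) {T : C} (e : T ≅ K.homology (-q))
    (z : approxCycles K Y.cochainComplex 2 p n) :
    cyclesToExt.{w} Y h e z = 0 ↔
      (z : Cochain K Y.cochainComplex n) ∈ approxBoundaries K Y.cochainComplex 2 p n := by
  rw [cyclesToExt_eq_zero_iff']
  refine ⟨fun ⟨g, hg⟩ => mem_approxBoundaries h z g hg, fun hz => ?_⟩
  obtain ⟨x, hx, _, ⟨y, hy, rfl⟩, hxy⟩ := AddSubgroup.mem_sup.1 hz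
  have hy' : diff K Y.cochainComplex (n - 1) n y ∈ approxCycles K Y.cochainComplex 2 p n := by
    have hy2 := diff_mem (p' := (p : ℤ)) (by lia) (show n - 1 + 1 = n by lia) hy
    refine ⟨hy2.1, ?_⟩
    change δ _ _ (δ _ _ y) ∈ filtration K Y.cochainComplex _ _
    rw [δ_δ]
    exact zero_mem _
  have hx' : x ∈ approxCycles K Y.cochainComplex 2 p n := by
    rw [eq_sub_of_add_eq hxy]
    exact sub_mem z.2 hy'
  obtain ⟨g, hg⟩ := leading_eq_of_eq_diff h ⟨_, hy'⟩ y hy rfl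
  refine ⟨g, ?_⟩
  have hz' : z = ⟨x, hx'⟩ + ⟨_, hy'⟩ := Subtype.ext hxy.symm
  rw [hz', leading_add, leading_eq_zero_of_mem h ⟨x, hx'⟩ hx, zero_add, hg]

lemma cyclesToExt_surjective {p : ℕ} {n q : ℤ} (h : p + q = n) {T : C}
    (e : T ≅ K.homology (-q)) : Function.Surjective (cyclesToExt.{w} Y h e) := by
  intro α
  obtain ⟨f, hf, rfl⟩ := Y.extMk_surjective α (p + 1) rfl
  obtain ⟨z, hz⟩ := exists_leading_eq h (e.inv ≫ f ≫ (Y.cochainComplexXIso p p rfl).inv)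
    (by simp [Y.cochainComplex_d p (p + 1) p (p + 1) rfl (by simp), reassoc_of% hf])
  refine ⟨z, ?_⟩
  simp [cyclesToExt, hz]

/-- The canonical isomorphism `E_2^{p,q} ≅ Ext^p(H^{-q}(K), N)`, for `n = p + q`. -/
def pageIsoExt {p : ℕ} {n q : ℤ} (h : p + q = n) {T : C} (e : T ≅ K.homology (-q)) :
    page K Y.cochainComplex 2 p n ≃+ Ext.{w} T N p :=
  AddEquiv.ofBijective
    (QuotientAddGroup.lift _ (cyclesToExt.{w} Y h e)
      (fun z hz => (cyclesToExt_eq_zero_iff.{w} Y h e z).2 hz))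
    ⟨by
      rw [injective_iff_map_eq_zero]
      intro x hx
      obtain ⟨z, rfl⟩ := QuotientAddGroup.mk_surjective x
      exact (QuotientAddGroup.eq_zero_iff _).2 ((cyclesToExt_eq_zero_iff.{w} Y h e z).1 hx),
    fun α => by
      obtain ⟨z, hz⟩ := cyclesToExt_surjective.{w} Y h e α
      exact ⟨QuotientAddGroup.mk z, hz⟩⟩

end SecondPage

/-! ### The change-of-rings spectral sequence -/

section Main

variable {A B : Type u} [Ring A] [Ring B] (φ : A →+* B)
  {M : ModuleCat.{u} A} {N : ModuleCat.{u} B}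
  (X : ProjectiveResolution M) (Y : InjectiveResolution N)

/-- The term `E_r^{p,q}`, with `p + q = n`, of the change-of-rings spectral sequence: the spectral
sequence of the complex `Hom_B(B ⊗_A X, Y)` filtered by the degree in `Y`. -/
abbrev E (r p n : ℤ) : Type u := page (tensorComplex φ X) Y.cochainComplex r p n

/-- The canonical isomorphism `E_2^{p,q} ≅ Ext_B^p(Tor_q^A(B, M), N)`, with `n = p + q`. -/
def E₂IsoExt (p : ℕ) (q n : ℤ) (h : p + q = n) :
    E φ X Y 2 p n ≃+ Ext.{u} (tor φ M q) N p :=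
  pageIsoExt Y h (torIso φ X q)

/-- The differential `d_2^{p,q} : Ext_B^p(Tor_q^A(B, M), N) → Ext_B^{p+2}(Tor_{q-1}^A(B, M), N)`
of the second page, under the canonical identifications. -/
def d₂ (p : ℕ) (q : ℤ) :
    Ext.{u} (tor φ M q) N p →+ Ext.{u} (tor φ M (q - 1)) N (p + 2) :=
  (E₂IsoExt φ X Y (p + 2) (q - 1) (p + q + 1) (by push_cast; ring)).toAddMonoidHom.comp
    ((pageD _ _ 2 p (p + 2 : ℕ) (p + q) (p + q + 1) (by simp) rfl).comp
      (E₂IsoExt φ X Y p q (p + q) rfl).symm.toAddMonoidHom)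

end Main

end

end ChangeOfRings

universe w'

namespace ChangeOfRings

/-! ### Cocycles of `Hom(K, L)` as shifted morphisms in the derived category. -/

section ShiftedHomOfCocycle

variable {C : Type u} [Category.{v} C]

/-! Put `K = B ⊗_A X`, `i = -q`, `j = i + 1`. The class `𝒪_q(M)` is, up to sign, the Yoneda class of
`0 ⟶ Hⁱ(K) ⟶ Kⁱ/Bⁱ ⟶ Zʲ ⟶ Hʲ(K) ⟶ 0`, the product of the extensions obtained by cutting it at `Bʲ`
(`obstruction`).

Represent `ζ` by `z` of degree `n = p + q`, with components `f : Kⁱ ⟶ Y^p` and `g : Kʲ ⟶ Y^(p+1)`.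
That `δ z` lies in `F^(p+2)` gives `d f = (-1)^n g d`: the extension of the cocycle from `Hⁱ` to
`Kⁱ/Bⁱ` has a differential that descends to `(-1)^n g` on `Bʲ`. On `Zʲ` the leading component of `δ
z` is `d g`. Thus `d₂` performs two connecting homomorphisms in succession, one for each extension
(`extOfCocycle_leading_diff`).

A connecting homomorphism ending in degree `m` is the Yoneda product with the extension class up to
`(-1)^m` (`extClass_comp_extOfCocycle`, proved with the mapping cone). The signs `(-1)^(p+1)` and
`(-1)^(p+2)` multiply to `-1`, so the total sign is `-(-1)^(p+q)`; the factor `-(-1)^q` goes into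
the class. Naturality of `obstruction` makes the class independent of `X` (`torObstruction_eq`). -/

lemma equivHomShift_comp_coe [Preadditive C] {K L M : CochainComplex C ℤ} {a b c : ℤ}
    (α : ShiftedHom K L a) (β : ShiftedHom L M b) (h : b + a = c) :
    (Cocycle.equivHomShift (α.comp β h) : Cochain K M c) =
      (Cocycle.equivHomShift α : Cochain K L a).comp
        (Cocycle.equivHomShift β : Cochain L M b) (by lia) := by
  subst h
  ext p q hpq
  rw [Cochain.comp_v _ _ _ p (p + a) q rfl (by lia)]
  simp only [Cocycle.equivHomShift_apply, Cocycle.rightUnshift_coe,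
    Cocycle.ofHom_coe, Cochain.rightUnshift_v _ _ _ _ _ _ _ (add_zero _), Cochain.ofHom_v,
    ShiftedHom.comp]
  simp [CochainComplex.shiftFunctorAdd'_inv_app_f']
  erw [Category.comp_id, Category.assoc, Category.assoc,
    HomologicalComplex.XIsoOfEq_hom_comp_XIsoOfEq_hom]

variable [Abelian C]

/-- The minus sign in the third morphism of the standard triangle contributes to the sign of the
connecting homomorphism. -/
lemma equivHomShift_triangle_mor₃ {K L : CochainComplex C ℤ} (f : K ⟶ L) :
    Cocycle.equivHomShift (K := mappingCone f) (L := K) (mappingCone.triangle f).mor₃ =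
      -mappingCone.fst f := by
  ext : 1
  simp [mappingCone.triangle, Cocycle.equivHomShift_apply]

variable [HasDerivedCategory.{w} C]

/-- The morphism in the derived category that is attached to a cocycle. -/
noncomputable def shiftedHomOfCocycle (K L : CochainComplex C ℤ) (n : ℤ) :
    Cocycle K L n →+
      ShiftedHom (DerivedCategory.Q.obj K) (DerivedCategory.Q.obj L) n :=
  AddMonoidHom.mk'
    (fun z => ShiftedHom.map (Cocycle.equivHomShift.symm z) DerivedCategory.Q)
    (fun z z' => by rw [map_add, ShiftedHom.map_add])

lemma shiftedHomOfCocycle_apply {K L : CochainComplex C ℤ} {n : ℤ} (z : Cocycle K L n) :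
    shiftedHomOfCocycle K L n z =
      ShiftedHom.map (Cocycle.equivHomShift.symm z) DerivedCategory.Q := rfl

/-- A coboundary corresponds to a null-homotopic morphism, which vanishes in the derived category.
-/
lemma shiftedHomOfCocycle_eq_zero {K L : CochainComplex C ℤ} {n : ℤ} (z : Cocycle K L n)
    (hz : z ∈ coboundaries K L n) : shiftedHomOfCocycle K L n z = 0 := by
  rw [← CohomologyClass.toHom_mk_eq_zero_iff, CohomologyClass.toHom_mk] at hz
  have h : DerivedCategory.Q.map (Cocycle.equivHomShift.symm z) = DerivedCategory.Q.map 0 :=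
    DerivedCategory.Q_map_eq_of_homotopy _
      (HomotopyCategory.homotopyOfEq _ _ (by rw [hz, Functor.map_zero]))
  rw [shiftedHomOfCocycle_apply, ShiftedHom.map, h, Functor.map_zero, zero_comp]

lemma shiftedHomOfCocycle_precomp {K' K L : CochainComplex C ℤ} {n : ℤ} (g : K' ⟶ K)
    (z : Cocycle K L n) :
    shiftedHomOfCocycle K' L n (z.precomp g) =
      DerivedCategory.Q.map g ≫ shiftedHomOfCocycle K L n z := by
  rw [shiftedHomOfCocycle_apply, Cocycle.equivHomShift_symm_precomp, ShiftedHom.map,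
    Functor.map_comp, Category.assoc]
  rfl

/-- Localization is compatible with shifted composition, so the product can be computed on cochains
as long as both factors come from actual morphisms of complexes. -/
lemma map_comp_shiftedHomOfCocycle {K L M : CochainComplex C ℤ} {a b c : ℤ}
    (α : ShiftedHom K L a) (z : Cocycle L M b) (h : b + a = c) (w : Cocycle K M c)
    (hw : (w : Cochain K M c) =
      (Cocycle.equivHomShift α : Cochain K L a).comp (z : Cochain L M b) (by lia)) :
    (α.map DerivedCategory.Q).comp (shiftedHomOfCocycle L M b z) h =
      shiftedHomOfCocycle K M c w := by
  rw [shiftedHomOfCocycle_apply, ← ShiftedHom.map_comp, shiftedHomOfCocycle_apply]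
  congr 1
  apply Cocycle.equivHomShift.injective
  ext : 1
  rw [equivHomShift_comp_coe, AddEquiv.apply_symm_apply, AddEquiv.apply_symm_apply, hw]

end ShiftedHomOfCocycle

/-! ### Connecting homomorphisms through the mapping cone, on cochains. -/

section MappingCone

variable {C : Type u} [Category.{v} C] [Abelian C]

lemma mappingCone_ofHom_descShortComplex (S : ShortComplex (CochainComplex C ℤ)) :
    Cochain.ofHom (mappingCone.descShortComplex S) =
      (mappingCone.snd S.f).comp (Cochain.ofHom S.g) (add_zero 0) := by
  simp [mappingCone.descShortComplex, mappingCone.desc, mappingCone.descCocycle,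
    mappingCone.descCochain]

/-- The cocycle of the mapping cone of `S.f` obtained from a cocycle `z₃` of `S.X₃` is cohomologous
up to sign to the one obtained from a cocycle `z₁` of `S.X₁`, if there is a cochain of `S.X₂`
which extends `z₁` and whose differential comes from `z₃`. -/
lemma precomp_descShortComplex_sub_mem_coboundaries (S : ShortComplex (CochainComplex C ℤ))
    {L : CochainComplex C ℤ} {n m : ℤ} (hm : n + 1 = m)
    (z₁ : Cocycle S.X₁ L n) (g : Cochain S.X₂ L n) (z₃ : Cocycle S.X₃ L m)
    (hg : (Cochain.ofHom S.f).comp g (zero_add n) = z₁)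
    (hz₃ : (Cochain.ofHom S.g).comp (z₃ : Cochain S.X₃ L m) (zero_add m) = δ n m g)
    (w : Cocycle (mappingCone S.f) L m)
    (hw : (w : Cochain (mappingCone S.f) L m) =
      (mappingCone.fst S.f : Cochain (mappingCone S.f) S.X₁ 1).comp
        (z₁ : Cochain S.X₁ L n) (by lia)) :
    z₃.precomp (mappingCone.descShortComplex S) - n.negOnePow • w ∈
      coboundaries (mappingCone S.f) L m := by
  rw [mem_coboundaries_iff _ n hm]
  -- Since `δ snd = -fst · f`, the differential of `snd · g` is `snd · δ g - (-1)^n fst · f · g`,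
  -- that is, the cocycle from `z₃` minus `(-1)^n` times the one from `z₁`.
  refine ⟨(mappingCone.snd S.f).comp g (zero_add n), ?_⟩
  rw [δ_zero_cochain_comp _ _ _ hm, mappingCone.δ_snd, ← hz₃]
  have h : ((z₃.precomp (mappingCone.descShortComplex S) - n.negOnePow • w :
      Cocycle (mappingCone S.f) L m) : Cochain (mappingCone S.f) L m) =
      (Cochain.ofHom (mappingCone.descShortComplex S)).comp z₃.1 (zero_add m) -
        n.negOnePow • (w : Cochain (mappingCone S.f) L m) := rfl
  rw [h, mappingCone_ofHom_descShortComplex, hw, ← hg]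
  simp [sub_eq_add_neg]

end MappingCone

/-! ### Formal composition of shifted morphisms. -/

section ShiftedHom

variable {D : Type*} [Category* D] [HasShift D ℤ] [Preadditive D]

/-- Transports a product formula along the isomorphisms between single objects in the derived
category and images of single complexes: the inner pair `c`, `c'` cancels. -/
lemma shiftedHom_comp_comp_mk₀ {X Y Z T U V : D} {k n m : ℤ} (a : X ⟶ Y) (b : ShiftedHom Y Z k)
    (c : Z ⟶ T) (c' : T ⟶ Z) (hc : c ≫ c' = 𝟙 Z) (F : ShiftedHom Z U n) (W : U ⟶ V)
    (h : n + k = m) (ε : ℤˣ) (G : ShiftedHom Y U m) (hG : b.comp F h = ε • G) :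
    ShiftedHom.comp (a ≫ b ≫ c⟦k⟧' : ShiftedHom X T k)
      ((ShiftedHom.mk₀ (0 : ℤ) rfl c').comp
        (F.comp (ShiftedHom.mk₀ (0 : ℤ) rfl W) (zero_add n)) (add_zero n)) h =
    ε • (ShiftedHom.mk₀ (0 : ℤ) rfl a).comp
      (G.comp (ShiftedHom.mk₀ (0 : ℤ) rfl W) (zero_add m)) (add_zero m) := by
  rw [ShiftedHom.comp] at hG
  rw [ShiftedHom.mk₀_comp, ShiftedHom.mk₀_comp, ShiftedHom.comp_mk₀, ShiftedHom.comp_mk₀,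
    ShiftedHom.comp, ← Linear.comp_units_smul, ← Linear.units_smul_comp, ← hG]
  have h1 : c⟦k⟧' ≫ c'⟦k⟧' = 𝟙 (Z⟦k⟧) := by rw [← Functor.map_comp, hc, CategoryTheory.Functor.map_id]
  have h2 := (CategoryTheory.shiftFunctorAdd' D n k m h).inv.naturality W
  simp only [Functor.map_comp, Category.assoc, reassoc_of% h1]
  rw [← h2]
  rfl

end ShiftedHom

/-! ### Extension classes acting on `Ext` classes given by injective cocycles. -/

section ExtOfCocycle

variable {C : Type u} [Category.{v} C] [Abelian C]

lemma singleδ_eq [HasDerivedCategory.{w'} C] {S : ShortComplex C} (hS : S.ShortExact) :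
    hS.singleδ = (DerivedCategory.singleFunctorIsoCompQ C 0).hom.app S.X₃ ≫
      DerivedCategory.triangleOfSESδ (hS.map_of_exact (HomologicalComplex.single C (ComplexShape.up ℤ) 0)) ≫
        ((DerivedCategory.singleFunctorIsoCompQ C 0).inv.app S.X₁)⟦(1 : ℤ)⟧' := by
  rw [ShortComplex.ShortExact.singleδ]
  simp only [SingleFunctors.evaluation_map, Functor.mapIso_hom, Functor.mapIso_inv,
    DerivedCategory.singleFunctorsPostcompQIso_hom_hom,
    DerivedCategory.singleFunctorsPostcompQIso_inv_hom]
  rfl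

/-- The connecting morphism is `mor₃` of the cone of `S.f` preceded by the inverse of the
quasi-isomorphism from the cone to `S.X₃`, so the identity can be checked on the cone. -/
lemma triangleOfSESδ_comp_shiftedHomOfCocycle [HasDerivedCategory.{w'} C]
    {S : ShortComplex (CochainComplex C ℤ)} (hS : S.ShortExact)
    {L : CochainComplex C ℤ} {n m : ℤ} (hm : n + 1 = m)
    (z₁ : Cocycle S.X₁ L n) (g : Cochain S.X₂ L n) (z₃ : Cocycle S.X₃ L m)
    (hg : (Cochain.ofHom S.f).comp g (zero_add n) = z₁)
    (hz₃ : (Cochain.ofHom S.g).comp (z₃ : Cochain S.X₃ L m) (zero_add m) = δ n m g) :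
    ShiftedHom.comp (DerivedCategory.triangleOfSESδ hS) (shiftedHomOfCocycle _ _ _ z₁) hm =
      m.negOnePow • shiftedHomOfCocycle _ _ _ z₃ := by
  have := mappingCone.quasiIso_descShortComplex hS
  have : IsIso (DerivedCategory.Q.map (mappingCone.descShortComplex S)) := inferInstance
  let w : Cocycle (mappingCone S.f) L m :=
    Cocycle.mk ((mappingCone.fst S.f : Cochain (mappingCone S.f) S.X₁ 1).comp
      (z₁ : Cochain S.X₁ L n) (by lia)) _ rfl (by
        rw [δ_comp _ _ (show 1 + n = m by lia) 2 (n + 1) (m + 1) rfl rfl rfl]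
        simp)
  have hw : ShiftedHom.comp (ShiftedHom.map (M := ℤ) (a := 1) (X := mappingCone S.f) (Y := S.X₁)
        (mappingCone.triangle S.f).mor₃ DerivedCategory.Q)
        (shiftedHomOfCocycle _ _ _ z₁) hm = shiftedHomOfCocycle _ _ _ (-w) := by
    apply map_comp_shiftedHomOfCocycle
    rw [equivHomShift_triangle_mor₃]
    simp [w]
  have h := shiftedHomOfCocycle_eq_zero _
    (precomp_descShortComplex_sub_mem_coboundaries S hm z₁ g z₃ hg hz₃ w rfl)
  rw [map_sub, sub_eq_zero, shiftedHomOfCocycle_precomp] at h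
  have h' : shiftedHomOfCocycle _ _ _ (n.negOnePow • w) =
    n.negOnePow • shiftedHomOfCocycle _ _ _ w := by
    rw [Units.smul_def, Units.smul_def, map_zsmul]
  -- On the cone, `z₃` becomes `(-1)^n w` and the left side becomes `-w`; these agree up to `(-1)^m`
  -- because `m + n = 2n + 1` is odd.
  rw [← cancel_epi (DerivedCategory.Q.map (mappingCone.descShortComplex S)),
    Linear.comp_units_smul, h, h', smul_smul, ← Int.negOnePow_add,
    Int.negOnePow_odd _ ⟨n, by lia⟩, Units.neg_smul, one_smul, ← map_neg, ← hw]
  simp [ShiftedHom.comp, ShiftedHom.map]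

variable [HasExt.{w} C]

/-- The class in `Ext X N n` of a cocycle `X ⟶ Rⁿ`. -/
noncomputable def extOfCocycle {X N : C} (R : InjectiveResolution N) {n : ℕ}
    (f : X ⟶ R.cochainComplex.X n) (hf : f ≫ R.cochainComplex.d n (n + 1) = 0) :
    Ext.{w} X N n :=
  R.extEquivCohomologyClass.symm (.mk (Cocycle.fromSingleMk f (zero_add _) _ rfl hf))

lemma extOfCocycle_hom [HasDerivedCategory.{w'} C] {X N : C} (R : InjectiveResolution N) {n : ℕ}
    (f : X ⟶ R.cochainComplex.X n) (hf : f ≫ R.cochainComplex.d n (n + 1) = 0) :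
    (extOfCocycle.{w} R f hf).hom =
      (ShiftedHom.mk₀ _ rfl ((DerivedCategory.singleFunctorIsoCompQ C 0).hom.app X)).comp
        ((shiftedHomOfCocycle _ _ _ (Cocycle.fromSingleMk f (zero_add _) _ rfl hf)).comp
        (.mk₀ _ rfl (inv (DerivedCategory.Q.map R.ι') ≫
          (DerivedCategory.singleFunctorIsoCompQ C 0).inv.app N)) (zero_add _)) (add_zero _) :=
  R.extEquivCohomologyClass_symm_mk_hom _

/-- The usual recipe for the connecting homomorphism: extend the cocycle to `S.X₂`, differentiate,
descend to `S.X₃`. The sign is that of the mapping cone. -/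
lemma extClass_comp_extOfCocycle {S : ShortComplex C} (hS : S.ShortExact) {N : C}
    (R : InjectiveResolution N) {n m : ℕ} (hm : 1 + n = m)
    (f : S.X₁ ⟶ R.cochainComplex.X n) (hf : f ≫ R.cochainComplex.d n (n + 1) = 0)
    (g : S.X₂ ⟶ R.cochainComplex.X n) (hg : S.f ≫ g = f)
    (h : S.X₃ ⟶ R.cochainComplex.X m) (hh : S.g ≫ h = g ≫ R.cochainComplex.d n m)
    (hh' : h ≫ R.cochainComplex.d m (m + 1) = 0) :
    hS.extClass.comp (extOfCocycle.{w} R f hf) hm =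
      (-1 : ℤ) ^ m • extOfCocycle R h hh' := by
  let := HasDerivedCategory.standard C
  apply Ext.homAddEquiv.injective
  rw [map_zsmul, Ext.homAddEquiv_apply, Ext.homAddEquiv_apply, Ext.comp_hom]
  have key := triangleOfSESδ_comp_shiftedHomOfCocycle
    (hS.map_of_exact (HomologicalComplex.single C (ComplexShape.up ℤ) 0))
    (L := R.cochainComplex) (n := n) (m := m) (by lia)
    (Cocycle.fromSingleMk f (zero_add _) _ rfl hf) (Cochain.fromSingleMk g (zero_add _))
    (Cocycle.fromSingleMk h (zero_add _) _ rfl hh') (by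
      subst hg
      exact (Cochain.fromSingleMk_precomp S.f g (zero_add _)).symm) (by
      refine (Cochain.fromSingleMk_precomp S.g h (zero_add _)).symm.trans ?_
      rw [hh]
      exact (Cochain.δ_fromSingleMk g (zero_add _) m m (by lia)).symm)
  rw [extOfCocycle_hom, extOfCocycle_hom, ShortComplex.ShortExact.extClass_hom, singleδ_eq]
  refine (shiftedHom_comp_comp_mk₀ _ _
    ((DerivedCategory.singleFunctorIsoCompQ C 0).inv.app S.X₁)
    ((DerivedCategory.singleFunctorIsoCompQ C 0).hom.app S.X₁)
    (Iso.inv_hom_id_app (DerivedCategory.singleFunctorIsoCompQ C 0) S.X₁)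
    _ _ (by lia) _ _ key).trans ?_
  rw [Units.smul_def, Int.coe_negOnePow_natCast]
  rfl

end ExtOfCocycle

/-! ### The four-term exact sequence of a complex and its class in `Ext²`. -/

section Obstruction

variable {C : Type u} [Category.{v} C] [Abelian C] (K L : CochainComplex C ℤ) (f : K ⟶ L)
  (i j : ℤ)

/-- The sequence `Hⁱ(K) ⟶ Kⁱ/Bⁱ ⟶ Bʲ`, where `j = i + 1`. -/
noncomputable abbrev opcyclesSequence : ShortComplex C :=
  ShortComplex.mk (K.homologyι i) (factorThruImage (K.opcyclesToCycles i j)) (by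
    rw [← cancel_mono (Limits.image.ι _), Category.assoc, Limits.image.fac, zero_comp,
      HomologicalComplex.homologyι_opcyclesToCycles])

/-- The sequence `Bʲ ⟶ Zʲ ⟶ Hʲ(K)`, where `j = i + 1`. -/
noncomputable abbrev cyclesSequence : ShortComplex C :=
  ShortComplex.mk (Limits.image.ι (K.opcyclesToCycles i j)) (K.homologyπ j) (by
    rw [← cancel_epi (factorThruImage _), Limits.image.fac_assoc, comp_zero,
      HomologicalComplex.opcyclesToCycles_homologyπ])

/-- This is the left half of the exact sequence `Hⁱ ⟶ Kⁱ/Bⁱ ⟶ Zʲ ⟶ Hʲ`; replacing `Zʲ` by the image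
of the middle map changes only the last term, along a monomorphism. -/
lemma opcyclesSequence_shortExact (hij : i + 1 = j) : (opcyclesSequence K i j).ShortExact where
  exact := by
    have h : (ShortComplex.mk (K.homologyι i) (K.opcyclesToCycles i j) (by simp)).Exact :=
      (HomologicalComplex.HomologySequence.composableArrows₃_exact K i j hij).exact 0
    refine (ShortComplex.exact_iff_of_epi_of_isIso_of_mono
      (S₁ := opcyclesSequence K i j)
      (S₂ := ShortComplex.mk (K.homologyι i) (K.opcyclesToCycles i j) (by simp))
      { τ₁ := 𝟙 _, τ₂ := 𝟙 _, τ₃ := Limits.image.ι _ }).2 h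
  mono_f := by dsimp; infer_instance
  epi_g := by dsimp; infer_instance

lemma cyclesSequence_shortExact (hij : i + 1 = j) : (cyclesSequence K i j).ShortExact where
  exact := by
    have h : (ShortComplex.mk (K.opcyclesToCycles i j) (K.homologyπ j) (by simp)).Exact :=
      (HomologicalComplex.HomologySequence.composableArrows₃_exact K i j hij).exact 1
    refine (ShortComplex.exact_iff_of_epi_of_isIso_of_mono
      (S₁ := ShortComplex.mk (K.opcyclesToCycles i j) (K.homologyπ j) (by simp))
      (S₂ := cyclesSequence K i j)
      { τ₁ := factorThruImage _, τ₂ := 𝟙 _, τ₃ := 𝟙 _ }).1 h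
  mono_f := by dsimp; infer_instance
  epi_g := by dsimp; infer_instance

variable {K L}

/-- The map `Bʲ(K) ⟶ Bʲ(L)`. -/
noncomputable def boundariesMap :
    Limits.image (K.opcyclesToCycles i j) ⟶ Limits.image (L.opcyclesToCycles i j) :=
  Limits.image.map (Arrow.homMk (HomologicalComplex.opcyclesMap f i) (HomologicalComplex.cyclesMap f j)
    (HomologicalComplex.opcyclesToCycles_naturality f i j) :
      Arrow.mk (K.opcyclesToCycles i j) ⟶ Arrow.mk (L.opcyclesToCycles i j))

@[simp]
lemma boundariesMap_ι :
    boundariesMap f i j ≫ Limits.image.ι _ =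
      Limits.image.ι _ ≫ HomologicalComplex.cyclesMap f j :=
  Limits.image.map_ι _

/-- The morphism of short exact sequences `opcyclesSequence` induced by a morphism of complexes. -/
noncomputable def opcyclesSequenceMap : opcyclesSequence K i j ⟶ opcyclesSequence L i j where
  τ₁ := HomologicalComplex.homologyMap f i
  τ₂ := HomologicalComplex.opcyclesMap f i
  τ₃ := boundariesMap f i j
  comm₁₂ := by simp
  comm₂₃ := by
    rw [← cancel_mono (Limits.image.ι _)]
    simp

/-- The morphism of short exact sequences `cyclesSequence` induced by a morphism of complexes. -/
noncomputable def cyclesSequenceMap : cyclesSequence K i j ⟶ cyclesSequence L i j where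
  τ₁ := boundariesMap f i j
  τ₂ := HomologicalComplex.cyclesMap f j
  τ₃ := HomologicalComplex.homologyMap f j
  comm₁₂ := by simp
  comm₂₃ := by simp

variable [HasExt.{w} C] (hij : i + 1 = j)

variable (K) in
/-- The class in `Ext²(Hʲ(K), Hⁱ(K))` of the exact sequence
`0 ⟶ Hⁱ(K) ⟶ Kⁱ/Bⁱ ⟶ Zʲ ⟶ Hʲ(K) ⟶ 0`, where `j = i + 1`. -/
noncomputable def obstruction : Ext.{w} (K.homology j) (K.homology i) 2 :=
  (cyclesSequence_shortExact K i j hij).extClass.comp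
    (opcyclesSequence_shortExact K i j hij).extClass (by rfl)

/-- Both extension classes are natural, and the two squares share the same map on `Bʲ`, so they can
be pasted. -/
lemma obstruction_naturality :
    (obstruction.{w} K i j hij).comp (Ext.mk₀ (HomologicalComplex.homologyMap f i)) (add_zero 2) =
      (Ext.mk₀ (HomologicalComplex.homologyMap f j)).comp (obstruction L i j hij) (zero_add 2) := by
  have h₁ := (opcyclesSequence_shortExact K i j hij).extClass_naturality
    (opcyclesSequence_shortExact L i j hij) (opcyclesSequenceMap f i j)
  have h₂ := (cyclesSequence_shortExact K i j hij).extClass_naturality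
    (cyclesSequence_shortExact L i j hij) (cyclesSequenceMap f i j)
  dsimp only [opcyclesSequenceMap, cyclesSequenceMap] at h₁ h₂
  rw [obstruction, obstruction, Ext.comp_assoc_of_third_deg_zero, h₁,
    ← Ext.comp_assoc_of_second_deg_zero, h₂, Ext.comp_assoc (a₁ := 0) (a₂ := 1) (a₃ := 1)]
  lia

end Obstruction

/-! ### The second differential as a double connecting homomorphism. -/

section SecondDifferential

variable {C : Type u} [Category.{v} C] [Abelian C] [HasExt.{w} C]

lemma extOfCocycle_units_smul {X N : C} (R : InjectiveResolution N) {n : ℕ} (ε : ℤˣ)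
    (f : X ⟶ R.cochainComplex.X n) (hf : f ≫ R.cochainComplex.d n (n + 1) = 0) :
    extOfCocycle.{w} R (ε • f) (by rw [Linear.units_smul_comp, hf, smul_zero]) =
      ε • extOfCocycle R f hf := by
  obtain rfl | rfl := Int.units_eq_one_or ε
  · simp
  · simp only [extOfCocycle, Units.neg_smul, one_smul]
    rw [Cocycle.fromSingleMk_neg _ _ _ _ hf]
    simp

variable {K : CochainComplex C ℤ} {N : C} (Y : InjectiveResolution N)

/-- Splits off the identification `e` and passes to the resolution indexed by `ℤ`, so that the
remaining computation takes place on `H^{-q}(K)`. -/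
lemma cyclesToExt_eq_mk₀_comp_extOfCocycle {p : ℕ} {n q : ℤ} (h : p + q = n) {T : C}
    (e : T ≅ K.homology (-q)) (z : approxCycles K Y.cochainComplex 2 p n) :
    cyclesToExt.{w} Y h e z =
      (Ext.mk₀ e.hom).comp (extOfCocycle Y (leading h z) (leading_comp_d h z)) (zero_add p) := by
  have hz := leading_comp_d h z
  have : extOfCocycle.{w} Y (leading h z) hz =
      Y.extMk (leading h z ≫ (Y.cochainComplexXIso p p rfl).hom) (p + 1) rfl (by
        rw [Y.cochainComplex_d p (p + 1) p (p + 1) rfl (by simp), ← Category.assoc,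
          ← Category.assoc, Preadditive.IsIso.comp_right_eq_zero] at hz
        exact hz) := by
    simp [extOfCocycle, InjectiveResolution.extMk]
  rw [this, InjectiveResolution.mk₀_comp_extMk]
  rfl

lemma extOfCocycle_leading_diff {p : ℕ} {n q : ℤ} (h : p + q = n)
    (z : approxCycles K Y.cochainComplex 2 p n)
    (z' : approxCycles K Y.cochainComplex 2 (p + 2 : ℕ) (n + 1))
    (hz' : (z' : Cochain K Y.cochainComplex (n + 1)) = diff K Y.cochainComplex n (n + 1) z) :
    extOfCocycle.{w} Y (leading (q := q - 1) (by push_cast; lia) z') (leading_comp_d _ z') =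
      -(n.negOnePow • (obstruction.{w} K (-q) (-(q - 1)) (by lia)).comp
        (extOfCocycle Y (leading h z) (leading_comp_d h z)) (add_comm 2 p)) := by
  -- The component of `δ z` from `K^{-q}` to `Y^(p+1)` vanishes because `δ z` lies in `F^(p+2)`.
  have h1 : K.descOpcycles ((z : Cochain K Y.cochainComplex n).v (-q) p (by lia)) (-q - 1)
        (by simp) (d_comp_leading (by lia) h z.2) ≫ Y.cochainComplex.d p (p + 1 : ℕ) =
      n.negOnePow • K.fromOpcycles (-q) (-(q - 1)) ≫
        (z : Cochain K Y.cochainComplex n).v (-(q - 1)) (p + 1 : ℕ) (by push_cast; lia) := by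
    have h0 : (δ n (n + 1) (z : Cochain K Y.cochainComplex n)).v (-q) (p + 1 : ℕ)
      (by push_cast; lia) = 0 := z.2.2 _ _ _ (by push_cast; lia)
    rw [δ_v n (n + 1) rfl _ (-q) (p + 1 : ℕ) (by push_cast; lia) p (-(q - 1)) (by push_cast; lia)
      (by lia), Int.negOnePow_succ, Units.neg_smul, add_neg_eq_zero] at h0
    rw [← cancel_epi (K.pOpcycles (-q)), Linear.comp_units_smul]
    simpa using h0
  -- The other term of `δ z` factors through the differential of `K`, which is zero on cycles.
  have h2 : K.homologyπ (-(q - 1)) ≫ leading (q := q - 1) (by push_cast; lia) z' =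
      K.iCycles (-(q - 1)) ≫
        (z : Cochain K Y.cochainComplex n).v (-(q - 1)) (p + 1 : ℕ) (by push_cast; lia) ≫
          Y.cochainComplex.d (p + 1 : ℕ) (p + 2 : ℕ) := by
    have h0 : (z' : Cochain K Y.cochainComplex (n + 1)).v (-(q - 1)) (p + 2 : ℕ)
        (by push_cast; lia) = (δ n (n + 1) (z : Cochain K Y.cochainComplex n)).v (-(q - 1))
          (p + 2 : ℕ) (by push_cast; lia) := by rw [hz']; rfl
    rw [δ_v n (n + 1) rfl _ _ (p + 2 : ℕ) (by push_cast; lia) (p + 1 : ℕ) (-(q - 1) + 1)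
      (by push_cast; lia) rfl] at h0
    rw [leading, HomologicalComplex.homology_π_ι_assoc, HomologicalComplex.p_descOpcycles, h0,
      Preadditive.comp_add, Linear.comp_units_smul, HomologicalComplex.iCycles_d_assoc, zero_comp,
      smul_zero, add_zero]
  have h3 : factorThruImage (K.opcyclesToCycles (-q) (-(q - 1))) ≫
      (n.negOnePow • Limits.image.ι _ ≫ K.iCycles _ ≫
        (z : Cochain K Y.cochainComplex n).v (-(q - 1)) (p + 1 : ℕ) (by push_cast; lia)) =
      K.descOpcycles ((z : Cochain K Y.cochainComplex n).v (-q) p (by lia)) (-q - 1)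
        (by simp) (d_comp_leading (by lia) h z.2) ≫ Y.cochainComplex.d p (p + 1 : ℕ) := by
    rw [h1, Linear.comp_units_smul, Limits.image.fac_assoc,
      HomologicalComplex.opcyclesToCycles_iCycles_assoc]
  have h4 : (n.negOnePow • Limits.image.ι (K.opcyclesToCycles (-q) (-(q - 1))) ≫ K.iCycles _ ≫
      (z : Cochain K Y.cochainComplex n).v (-(q - 1)) (p + 1 : ℕ) (by push_cast; lia)) ≫
        Y.cochainComplex.d (p + 1 : ℕ) ((p + 1 : ℕ) + 1) = 0 := by
    rw [← cancel_epi (factorThruImage _), reassoc_of% h3, HomologicalComplex.d_comp_d,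
      comp_zero, comp_zero]
  -- `leading` is by definition the restriction of the `descOpcycles` map to homology, so that map
  -- is the required extension.
  have h5 := extClass_comp_extOfCocycle.{w} (opcyclesSequence_shortExact K (-q) (-(q - 1)) (by lia))
    Y (n := p) (m := p + 1) (by lia) (leading h z) (leading_comp_d h z) _ rfl _ h3 h4
  have h6 := extClass_comp_extOfCocycle.{w} (cyclesSequence_shortExact K (-q) (-(q - 1)) (by lia))
    Y (n := p + 1) (m := p + 2) (by lia) _ h4
    (n.negOnePow • K.iCycles _ ≫
      (z : Cochain K Y.cochainComplex n).v (-(q - 1)) (p + 1 : ℕ) (by push_cast; lia))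
    (Linear.comp_units_smul _ _ _)
    (n.negOnePow • leading (q := q - 1) (by push_cast; lia) z')
    (by rw [Linear.comp_units_smul, h2, Linear.units_smul_comp, Category.assoc])
    (by rw [Linear.units_smul_comp, leading_comp_d, smul_zero])
  rw [extOfCocycle_units_smul _ _ _ (leading_comp_d _ z')] at h6
  rw [obstruction, Ext.comp_assoc (a₂₃ := p + 1) _ _ _ _ (by lia) (by lia), h5]
  -- The signs from `h5` and `h6` have product `(-1)^(2p+3) = -1`; the factor `(-1)^n` comes from
  -- `h1`.
  obtain hn | hn := Int.units_eq_one_or n.negOnePow <;>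
    obtain hp | hp := neg_one_pow_eq_or ℤ p <;>
    simp only [hn, hp, pow_succ, one_smul, Units.neg_smul, neg_smul, mul_neg, mul_one, neg_neg,
      Ext.comp_neg] at h6 ⊢ <;>
    rw [h6] <;> simp

end SecondDifferential

/-! ### The class on `Tor` and its independence of the projective resolution. -/

section TorObstruction

variable {A B : Type u} [Ring A] [Ring B] (φ : A →+* B) {M : ModuleCat.{u} A}

/-- The morphism `B ⊗_A X ⟶ B ⊗_A X'` induced by a morphism of projective resolutions. -/
noncomputable def tensorComplexMap {X X' : ProjectiveResolution M} (g : X.complex ⟶ X'.complex) :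
    tensorComplex φ X ⟶ tensorComplex φ X' :=
  HomologicalComplex.extendMap
    (((tensorFunctor φ).mapHomologicalComplex (ComplexShape.down ℕ)).map g)
    ComplexShape.embeddingDownNat

/-- For `n ≥ 0` this combines naturality of the derived-functor isomorphism over `𝟙 M` with
naturality of extension by zero; for `n < 0` the source is zero. -/
lemma torIso_hom_comp_homologyMap {X X' : ProjectiveResolution M}
    (g : X.complex ⟶ X'.complex) (hg : g ≫ X'.π = X.π) (n : ℤ) :
    (torIso φ X n).hom ≫ HomologicalComplex.homologyMap (tensorComplexMap φ g) (-n) =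
      (torIso φ X' n).hom := by
  obtain n | n := n
  · have h := ProjectiveResolution.isoLeftDerivedObj_hom_naturality (𝟙 M) X X' g
      (by rw [← hg]; simp) (tensorFunctor φ) n
    rw [CategoryTheory.Functor.map_id, Category.id_comp] at h
    have h' := HomologicalComplex.extendHomologyIso_hom_naturality
      (((tensorFunctor φ).mapHomologicalComplex (ComplexShape.down ℕ)).map g)
      ComplexShape.embeddingDownNat (j := n) (j' := -(n : ℤ)) rfl
    have aux : ∀ {P P₁ P₂ Q₁ Q₂ : ModuleCat.{u} B} (a : P ⟶ P₁) (b : P ⟶ P₂) (k : P₁ ⟶ P₂)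
        (e₁ : Q₁ ≅ P₁) (e₂ : Q₂ ≅ P₂) (m : Q₁ ⟶ Q₂), b = a ≫ k → m ≫ e₂.hom = e₁.hom ≫ k →
        (a ≫ e₁.inv) ≫ m = b ≫ e₂.inv := by
      intro P P₁ P₂ Q₁ Q₂ a b k e₁ e₂ m hb hm
      rw [Iso.eq_comp_inv, Category.assoc, Category.assoc, hm, Iso.inv_hom_id_assoc, hb]
    exact aux _ _ _ _ _ _ h h'
  · exact (ModuleCat.isZero_of_subsingleton (ModuleCat.of B PUnit.{u + 1})).eq_of_src _ _

/-- The class `𝒪_q(M)` up to sign, computed with a projective resolution of `M`. -/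
noncomputable def torObstruction (X : ProjectiveResolution M) (q : ℤ) :
    Ext.{u} (tor φ M (q - 1)) (tor φ M q) 2 :=
  (Ext.mk₀ (torIso φ X (q - 1)).hom).comp
    ((obstruction (tensorComplex φ X) (-q) (-(q - 1)) (by lia)).comp
      (Ext.mk₀ (torIso φ X q).inv) (add_zero 2)) (zero_add 2)

/-- A lift of `𝟙 M` compares the resolutions, and its action on homology is absorbed by `torIso`.
This is needed because the class must be fixed before `X` is given. -/
lemma torObstruction_eq (X X' : ProjectiveResolution M) (q : ℤ) :
    torObstruction φ X q = torObstruction φ X' q := by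
  let g := ProjectiveResolution.lift (𝟙 M) X X'
  have hg : g ≫ X'.π = X.π := by simp [g]
  have h := obstruction_naturality.{u} (tensorComplexMap φ g) (-q) (-(q - 1)) (by lia)
  have h₁ := torIso_hom_comp_homologyMap φ g hg q
  have h₂ : (torIso φ X q).inv =
      HomologicalComplex.homologyMap (tensorComplexMap φ g) (-q) ≫ (torIso φ X' q).inv := by
    rw [Iso.eq_comp_inv, Iso.inv_comp_eq, h₁]
  have h₃ : (obstruction.{u} (tensorComplex φ X) (-q) (-(q - 1)) (by lia)).comp
      (Ext.mk₀ (torIso φ X q).inv) (add_zero 2) =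
      (Ext.mk₀ (HomologicalComplex.homologyMap (tensorComplexMap φ g) (-(q - 1)))).comp
        ((obstruction (tensorComplex φ X') (-q) (-(q - 1)) (by lia)).comp
          (Ext.mk₀ (torIso φ X' q).inv) (add_zero 2)) (zero_add 2) := by
    rw [h₂, ← Ext.mk₀_comp_mk₀, ← Ext.comp_assoc_of_third_deg_zero, h,
      Ext.comp_assoc_of_third_deg_zero]
  rw [torObstruction, torObstruction, h₃, Ext.mk₀_comp_mk₀_assoc,
    torIso_hom_comp_homologyMap φ g hg]

lemma d₂_apply {N : ModuleCat.{u} B} (X : ProjectiveResolution M) (Y : InjectiveResolution N)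
    (p : ℕ) (q : ℤ) (ζ : Ext.{u} (tor φ M q) N p) :
    d₂ φ X Y p q ζ = -((p + q).negOnePow • (torObstruction φ X q).comp ζ (add_comm 2 p)) := by
  obtain ⟨z, rfl⟩ := cyclesToExt_surjective.{u} Y (n := p + q) rfl (torIso φ X q) ζ
  -- The class `ζ` is now that of `z` on the second page, and the page differential sends it to the
  -- class of `δ z` by construction.
  have h1 : (E₂IsoExt φ X Y p q (p + q) rfl).symm
      (cyclesToExt.{u} Y rfl (torIso φ X q) z) = QuotientAddGroup.mk z := by
    rw [AddEquiv.symm_apply_eq]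
    rfl
  have h2 : d₂ φ X Y p q (cyclesToExt.{u} Y rfl (torIso φ X q) z) =
      cyclesToExt.{u} Y (by push_cast; lia) (torIso φ X (q - 1))
        ⟨diff _ _ (p + q) (p + q + 1) z, diff_mem (show (p : ℤ) + 2 = (p + 2 : ℕ) by simp) rfl z.2⟩ := by
    change (E₂IsoExt φ X Y (p + 2) (q - 1) (p + q + 1) _)
      (pageD _ _ 2 p (p + 2 : ℕ) (p + q) (p + q + 1) (by simp) rfl _) = _
    erw [h1]
    rfl
  have h3 : ∀ x : Ext.{u} ((tensorComplex φ X).homology (-q)) N p,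
      (torObstruction φ X q).comp ((Ext.mk₀ (torIso φ X q).hom).comp x (zero_add p))
        (add_comm 2 p) =
      (Ext.mk₀ (torIso φ X (q - 1)).hom).comp
        ((obstruction (tensorComplex φ X) (-q) (-(q - 1)) (by lia)).comp x (add_comm 2 p))
        (zero_add (p + 2)) := by
    intro x
    rw [torObstruction, Ext.comp_assoc (a₁ := 0) (a₂ := 2) (a₂₃ := p + 2) _ _ _ _ (by lia) (by lia),
      Ext.comp_assoc_of_second_deg_zero, Ext.mk₀_comp_mk₀_assoc, Iso.inv_hom_id, Ext.mk₀_id_comp]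
  rw [h2, cyclesToExt_eq_mk₀_comp_extOfCocycle, cyclesToExt_eq_mk₀_comp_extOfCocycle,
    extOfCocycle_leading_diff Y rfl z _ rfl, h3]
  obtain hn | hn := Int.units_eq_one_or (p + q : ℤ).negOnePow <;> simp [hn, Ext.comp_neg]

end TorObstruction

end ChangeOfRings

theorem mainTheorem2 {k : Type w} [Field k] {A B : Type u} [Ring A] [Algebra k A]
    [Ring B] [Algebra k B] (φ : A →ₐ[k] B) (M : ModuleCat.{u} A) (q : ℤ) :
    ∃ O : Ext.{u} (ChangeOfRings.tor (φ : A →+* B) M (q - 1))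
        (ChangeOfRings.tor (φ : A →+* B) M q) 2,
      ∀ (N : ModuleCat.{u} B) (X : ProjectiveResolution M) (Y : InjectiveResolution N)
        (p : ℕ) (ζ : Ext.{u} (ChangeOfRings.tor (φ : A →+* B) M q) N p),
        ChangeOfRings.d₂ (φ : A →+* B) X Y p q ζ =
          (-1 : ℤ) ^ p • O.comp ζ (add_comm 2 p) := by
  -- Of the sign `-(-1)^(p+q)` in `d₂_apply`, the part `-(-1)^q` depends only on `q` and is put into
  -- the class, leaving `(-1)^p`.
  refine ⟨-(q.negOnePow • ChangeOfRings.torObstruction (φ : A →+* B) (projectiveResolution M) q),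
    fun N X Y p ζ => ?_⟩
  rw [ChangeOfRings.d₂_apply, ChangeOfRings.torObstruction_eq _ X (projectiveResolution M),
    Int.negOnePow_add, mul_smul, Units.smul_def (p : ℤ).negOnePow, Int.coe_negOnePow_natCast]
  obtain hq | hq := Int.units_eq_one_or q.negOnePow <;> simp [hq, Ext.neg_comp]
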